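/- Consider tabular episodic MDPs $(\mathcal S,\mathcal A,P,r,H,\rho)$ with finite state and action sets, horizon $H$, initial distribution $\rho$, transitions $P_h(\cdot\mid s,a)$ and rewards $r_h(s,a)\in[0,1]$ for $h=1,\dots,H$. For a non-stationary stochastic policy $\pi=(\pi_h(\cdot\mid s))_{h,s}$ let $d_h^\pi(s,a)=\mathbb P(s_h=s,a_h=a)$ and let $V(\pi)=\mathbb E\big[\sum_{h=1}^H r_h(s_h,a_h)\big]$. Given $N$ independent trajectories of an expert policy $\pi^{\mathrm E}$, let $\widehat d_h(s,a)$ be the fraction of the trajectories with $(s_h,a_h)=(s,a)$. TV-AIL minimizes $$\sum_{h=1}^H\sum_{(s,a)\in\mathcal S\times\mathcal A}\big|d_h^\pi(s,a)-\widehat d_h(s,a)\big|$$ over all policies $\pi$, viewed as points of $\mathbb R^{H|\mathcal S||\mathcal A|}$; it outputs $\pi^{\mathrm{AIL}}$ drawn from the uniform distribution on the set of all minimizers, i.e. from normalized Hausdorff measure in the dimension of that set. An MDP with an expert policy has isolated absorbing states if $P_h(s\mid s,a)=1$ for all $h,s,a$, and there is an action $a^1$ that the expert plays with probability $1$ at every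 step and state, with $r_h(s,a^1)=1$ and $r_h(s,a)=0$ for all $h$, $s$ and $a\neq a^1$. **Proposition.** There is an absolute constant $c>0$ such that, for all finite sets $\mathcal S,\mathcal A$ with $|\mathcal S|\ge 2$ and $|\mathcal A|\ge 2$ and every $H\ge 1$, there is a tabular episodic MDP on $\mathcal S,\mathcal A$ with horizon $H$ and an expert policy $\pi^{\mathrm E}$, with isolated absorbing states, such that for every $N\ge 1$ the uniform distribution on the set of minimizers is a well-defined probability measure that integrates $V$ (whatever the dataset), and $$V(\pi^{\mathrm E})-\mathbb E\big[V(\pi^{\mathrm{AIL}})\big]\;\ge\; c\,\min\Big\{H,\;H\sqrt{|\mathcal S|/N}\Big\},$$ where the expectation is over the $N$ expert trajectories and the uniform choice of $\pi^{\mathrm{AIL}}$. -/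

import Mathlib

open MeasureTheory

noncomputable section

namespace ImitationLearning

/-- A tabular episodic Markov decision process with horizon `H`. The time steps `1, …, H` are
indexed by `Fin H`, starting from `0`. -/
structure EpisodicMDP (S A : Type*) [Fintype S] (H : ℕ) where
  /-- The initial state distribution. -/
  ρ : S → ℝ
  ρ_mem : ρ ∈ stdSimplex ℝ S
  /-- `P h s a s'` is the probability of moving from `s` to `s'` under action `a` at step `h`. -/
  P : Fin H → S → A → S → ℝ
  P_mem : ∀ h s a, P h s a ∈ stdSimplex ℝ S
  /-- The reward function. -/
  r : Fin H → S → A → ℝ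
  r_mem : ∀ h s a, r h s a ∈ Set.Icc (0 : ℝ) 1

/-- A trajectory `(s_1, a_1, …, s_H, a_H)`. -/
abbrev Trajectory (S A : Type*) (H : ℕ) : Type _ := Fin H → S × A

/-- The Euclidean space that contains the non-stationary stochastic policies; the coordinate
`π (h, s, a)` is the probability `π_h (a | s)`. -/
abbrev PolicySpace (S A : Type*) (H : ℕ) : Type _ := EuclideanSpace ℝ (Fin H × S × A)

/-- The set `Π` of all non-stationary stochastic policies. -/
def policies (S A : Type*) [Fintype A] (H : ℕ) : Set (PolicySpace S A H) :=
  {π | ∀ h s, (fun a => π (h, s, a)) ∈ stdSimplex ℝ A}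

/-- Normalized Hausdorff measure on `K`, in the dimension of `K`. If `K` is a nonempty compact
convex set, this is normalized Lebesgue measure of the affine hull of `K`, restricted to `K`. -/
def uniformMeasure {E : Type*} [EMetricSpace E] [MeasurableSpace E] [BorelSpace E]
    (K : Set E) : Measure E :=
  ProbabilityTheory.cond (Measure.hausdorffMeasure (dimH K).toReal) K

namespace EpisodicMDP

variable {S A : Type*} [Fintype S] {H : ℕ}

/-- The probability of a trajectory under a policy:
`ρ(s_1) π_1(a_1|s_1) ∏_{h=1}^{H-1} P_h(s_{h+1}|s_h,a_h) π_{h+1}(a_{h+1}|s_{h+1})`. -/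
def trajProb (M : EpisodicMDP S A H) (π : PolicySpace S A H) (tr : Trajectory S A H) : ℝ :=
  ∏ h : Fin H,
    (if (h : ℕ) = 0 then M.ρ (tr h).1
      else
        let k : Fin H := ⟨(h : ℕ) - 1, by omega⟩
        M.P k (tr k).1 (tr k).2 (tr h).1) *
    π (h, (tr h).1, (tr h).2)

/-- The policy value `V(π)`, the expected total reward of an episode. -/
def value [Fintype A] (M : EpisodicMDP S A H) (π : PolicySpace S A H) : ℝ :=
  ∑ tr : Trajectory S A H, M.trajProb π tr * ∑ h, M.r h (tr h).1 (tr h).2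

/-- The state-action distribution `d_h^π(s, a)`, the probability that `s_h = s` and `a_h = a`. -/
def occupancy [Fintype A] [DecidableEq S] [DecidableEq A]
    (M : EpisodicMDP S A H) (π : PolicySpace S A H) (h : Fin H) (s : S) (a : A) : ℝ :=
  ∑ tr : Trajectory S A H, if tr h = (s, a) then M.trajProb π tr else 0

end EpisodicMDP

/-- The empirical state-action distribution at step `h` of a dataset of `N` trajectories. -/
def empirical {S A : Type*} [DecidableEq S] [DecidableEq A] {H N : ℕ}
    (D : Fin N → Trajectory S A H) (h : Fin H) (s : S) (a : A) : ℝ :=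
  ((Finset.univ.filter fun i => D i h = (s, a)).card : ℝ) / N

namespace EpisodicMDP

variable {S A : Type*} [Fintype S] [Fintype A] [DecidableEq S] [DecidableEq A] {H N : ℕ}

/-- The objective of TV-AIL: the sum over the steps of the `ℓ¹` distance between the
state-action distribution of the policy and the empirical one. -/
def tvLoss (M : EpisodicMDP S A H) (D : Fin N → Trajectory S A H) (π : PolicySpace S A H) : ℝ :=
  ∑ h, ∑ s, ∑ a, |M.occupancy π h s a - empirical D h s a|

/-- The set of optimal solutions of TV-AIL on the dataset `D`. -/
def tvAIL (M : EpisodicMDP S A H) (D : Fin N → Trajectory S A H) : Set (PolicySpace S A H) :=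
  {π | π ∈ policies S A H ∧ ∀ π' ∈ policies S A H, M.tvLoss D π ≤ M.tvLoss D π'}

/-- The law of the output of TV-AIL on the dataset `D`, with ties broken uniformly. -/
def tvAILLaw (M : EpisodicMDP S A H) (D : Fin N → Trajectory S A H) :
    Measure (PolicySpace S A H) :=
  uniformMeasure (M.tvAIL D)

/-- The expected value `E[V(π^AIL)]`: the dataset consists of `N` independent trajectories of
the expert `πE`, and the output is then drawn uniformly from the optimal solutions. -/
def expectedAILValue (M : EpisodicMDP S A H) (πE : PolicySpace S A H) (N : ℕ) : ℝ :=
  ∑ D : Fin N → Trajectory S A H,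
    (∏ i, M.trajProb πE (D i)) * ∫ π, M.value π ∂(M.tvAILLaw D)

end EpisodicMDP

/-- MDPs with isolated absorbing states: every action keeps every state in place, and there is
an action `a₁` that the expert plays in all states and steps, with reward `1`, whereas all
other actions have reward `0`. -/
def IsolatedAbsorbing {S A : Type*} [Fintype S] {H : ℕ}
    (M : EpisodicMDP S A H) (πE : PolicySpace S A H) : Prop :=
  (∀ h s a, M.P h s a s = 1) ∧
  ∃ a₁ : A, ∀ h s, πE (h, s, a₁) = 1 ∧ M.r h s a₁ = 1 ∧ ∀ a, a ≠ a₁ → M.r h s a = 0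

end ImitationLearning

end

/-!
If every step of every trajectory in the dataset plays `a₁`, as happens almost surely under the
expert, then for absorbing states the loss of a policy `π` is
`∑ h s, (|ρ s * π_h(a₁ | s) - q_h s| + ρ s * (1 - π_h(a₁ | s)))`, where `q_h s` is the empirical
frequency of `(s, a₁)` at step `h`. Each summand is at least `|ρ s - q_h s|`, with equality if and
only if `π_h(a₁ | s) ≥ min (q_h s / ρ s) 1`. So the expert is a minimizer, but in a state which the
dataset underrepresents a minimizer may play `a₁` with any probability above this threshold.

For a fixed step and state, the set of minimizers is invariant under the isometry exchanging the
probabilities of `a₁` and of another action relative to the threshold. Hence a uniform minimizer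
plays `a₁` with mean at most the midpoint of the threshold and `1`. Since `ρ` and `q_h` have the
same mass, half of `∑ s, |ρ s - q_h s|` is the total underrepresented mass, and the expected
suboptimality is at least a quarter of the expected loss of the expert.

It remains to bound the mean absolute deviation of an empirical frequency from below. Hölder's
inequality bounds a first moment below in terms of the second and fourth moments, which are explicit
for sums of independent centred variables. For uniform `ρ` the deviations sum to order
`min 1 √(|S| / N)` at each step.
-/

namespace ImitationLearning

section WeightedSums

lemma sum_filter_prod_eq {ι α R : Type*} [Fintype ι] [DecidableEq ι] [Fintype α] [DecidableEq α]
    [CommSemiring R] {f : ι → α → R} {i : ι} (hf : ∀ j ≠ i, ∑ x, f j x = 1) (x : α) :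
    ∑ p : ι → α with p i = x, ∏ j, f j (p j) = f i x := by
  rw [← Fintype.piFinset_univ, ← Fintype.piFinset_update_singleton_eq_filter_piFinset_eq
    (fun _ => Finset.univ) i (Finset.mem_univ x), ← Finset.prod_univ_sum,
    Finset.prod_eq_single i]
  · simp
  · intro j _ hj
    simp [hj, hf j hj]
  · simp

lemma sum_mul_sq_pow_three_le {ι R : Type*} [CommRing R] [LinearOrder R] [IsStrictOrderedRing R]
    (s : Finset ι) {w : ι → R} (hw : ∀ i ∈ s, 0 ≤ w i) (x : ι → R) :
    (∑ i ∈ s, w i * x i ^ 2) ^ 3 ≤ (∑ i ∈ s, w i * |x i|) ^ 2 * ∑ i ∈ s, w i * x i ^ 4 := by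
  set m₁ := ∑ i ∈ s, w i * |x i|
  set m₂ := ∑ i ∈ s, w i * x i ^ 2
  set m₃ := ∑ i ∈ s, w i * |x i| ^ 3
  set m₄ := ∑ i ∈ s, w i * x i ^ 4
  have h₁ : ∀ i ∈ s, 0 ≤ w i * |x i| := fun i hi => mul_nonneg (hw i hi) (abs_nonneg _)
  have h₂ : ∀ i ∈ s, 0 ≤ w i * x i ^ 2 := fun i hi => mul_nonneg (hw i hi) (sq_nonneg _)
  have h₃ : ∀ i ∈ s, 0 ≤ w i * |x i| ^ 3 := fun i hi => mul_nonneg (hw i hi) (by positivity)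
  have h₄ : ∀ i ∈ s, 0 ≤ w i * x i ^ 4 := fun i hi => mul_nonneg (hw i hi) (by positivity)
  have h₁₃ : m₂ ^ 2 ≤ m₁ * m₃ := Finset.sum_sq_le_sum_mul_sum_of_sq_le_mul s h₁ h₃ fun i _ => by
    rw [← sq_abs (x i)]; exact le_of_eq (by ring)
  have h₂₄ : m₃ ^ 2 ≤ m₂ * m₄ := Finset.sum_sq_le_sum_mul_sum_of_sq_le_mul s h₂ h₄ fun i _ => by
    rw [← (show Even 4 by decide).pow_abs (x i), ← sq_abs (x i)]; exact le_of_eq (by ring)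
  have hm₂ : 0 ≤ m₂ := Finset.sum_nonneg h₂
  rcases hm₂.eq_or_lt with hzero | hpos
  · rw [← hzero, zero_pow three_ne_zero]
    exact mul_nonneg (sq_nonneg _) (Finset.sum_nonneg h₄)
  · refine le_of_mul_le_mul_left ?_ hpos
    calc m₂ * m₂ ^ 3 = (m₂ ^ 2) ^ 2 := by ring
      _ ≤ (m₁ * m₃) ^ 2 := pow_le_pow_left₀ (sq_nonneg _) h₁₃ 2
      _ = m₁ ^ 2 * m₃ ^ 2 := by ring
      _ ≤ m₁ ^ 2 * (m₂ * m₄) := by gcongr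
      _ = m₂ * (m₁ ^ 2 * m₄) := by ring

end WeightedSums

section Sampling

variable {T : Type*} [Fintype T] {N : ℕ}

/-- The expectation of `F` over a sample of `N` independent draws with weights `w`; a weight
function of total mass `1` stands for a distribution on `T`. -/
def iidExpect {R : Type*} [CommSemiring R] (w : T → R) (F : (Fin N → T) → R) : R :=
  ∑ D, (∏ i, w (D i)) * F D

section CommSemiring

variable {R : Type*} [CommSemiring R] {w : T → R}

lemma iidExpect_const (hw : ∑ t, w t = 1) (c : R) : iidExpect w (fun _ : Fin N → T => c) = c := by
  rw [iidExpect, ← Finset.sum_mul, ← Fintype.sum_pow, hw, one_pow, one_mul]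

lemma iidExpect_finsetSum {ι : Type*} (s : Finset ι) (F : ι → (Fin N → T) → R) :
    iidExpect w (fun D => ∑ j ∈ s, F j D) = ∑ j ∈ s, iidExpect w (F j) := by
  simp only [iidExpect, Finset.mul_sum]
  exact Finset.sum_comm

lemma iidExpect_mul_const (F : (Fin N → T) → R) (c : R) :
    iidExpect w (fun D => F D * c) = iidExpect w F * c := by
  simp only [iidExpect, Finset.sum_mul, mul_assoc]

lemma iidExpect_cons (F : (Fin (N + 1) → T) → R) :
    iidExpect w F = ∑ t, w t * iidExpect w fun D : Fin N → T => F (Fin.cons t D) := by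
  rw [iidExpect, ← (Fin.consEquiv fun _ => T).sum_comp, Fintype.sum_prod_type]
  refine Finset.sum_congr rfl fun t _ => ?_
  rw [iidExpect, Finset.mul_sum]
  refine Finset.sum_congr rfl fun D _ => ?_
  rw [Fin.prod_univ_succ, mul_assoc]
  rfl

lemma iidExpect_sum_pow_succ (f : T → R) (k : ℕ) :
    iidExpect w (fun D : Fin (N + 1) → T => (∑ i, f (D i)) ^ k) =
      ∑ j ∈ Finset.range (k + 1), (∑ t, w t * f t ^ j) *
        iidExpect w (fun D : Fin N → T => (∑ i, f (D i)) ^ (k - j)) * k.choose j := by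
  simp only [iidExpect_cons, Fin.sum_univ_succ, Fin.cons_zero, Fin.cons_succ, add_pow,
    iidExpect_finsetSum, iidExpect_mul_const, Finset.mul_sum, Finset.sum_mul]
  rw [Finset.sum_comm]
  refine Finset.sum_congr rfl fun j _ => Finset.sum_congr rfl fun t _ => ?_
  simp only [iidExpect, Finset.mul_sum, Finset.sum_mul]
  exact Finset.sum_congr rfl fun D _ => by ring

end CommSemiring

section CommRing

variable {R : Type*} [CommRing R] {w f : T → R}

lemma iidExpect_sub (F G : (Fin N → T) → R) :
    iidExpect w (fun D => F D - G D) = iidExpect w F - iidExpect w G := by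
  simp only [iidExpect, mul_sub, Finset.sum_sub_distrib]

lemma iidExpect_sum_eq_zero (hw : ∑ t, w t = 1) (hf : ∑ t, w t * f t = 0) :
    iidExpect w (fun D : Fin N → T => ∑ i, f (D i)) = 0 := by
  induction N with
  | zero => simp [iidExpect]
  | succ n ih =>
    have hsucc := iidExpect_sum_pow_succ (w := w) (N := n) f 1
    simpa [Finset.sum_range_succ, hw, hf, ih] using hsucc

lemma iidExpect_sum_sq (hw : ∑ t, w t = 1) (hf : ∑ t, w t * f t = 0) :
    iidExpect w (fun D : Fin N → T => (∑ i, f (D i)) ^ 2) = N * ∑ t, w t * f t ^ 2 := by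
  induction N with
  | zero => simp [iidExpect]
  | succ n ih =>
    simp only [iidExpect_sum_pow_succ, Finset.sum_range_succ, Finset.sum_range_zero, pow_zero,
      pow_one, mul_one, hw, hf, ih, iidExpect_const hw, Nat.choose, Nat.reduceSub]
    push_cast
    ring

lemma iidExpect_sum_pow_four (hw : ∑ t, w t = 1) (hf : ∑ t, w t * f t = 0) :
    iidExpect w (fun D : Fin N → T => (∑ i, f (D i)) ^ 4) =
      N * ∑ t, w t * f t ^ 4 + 3 * N * (N - 1) * (∑ t, w t * f t ^ 2) ^ 2 := by
  induction N with
  | zero => simp [iidExpect]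
  | succ n ih =>
    simp only [iidExpect_sum_pow_succ, Finset.sum_range_succ, Finset.sum_range_zero, pow_zero,
      pow_one, mul_one, hw, hf, ih, iidExpect_const hw, iidExpect_sum_eq_zero hw hf,
      iidExpect_sum_sq hw hf, Nat.choose, Nat.reduceSub]
    push_cast
    ring

end CommRing

lemma iidExpect_mono {R : Type*} [CommRing R] [LinearOrder R] [IsStrictOrderedRing R] {w : T → R}
    (hw : ∀ t, 0 ≤ w t) {F G : (Fin N → T) → R} (h : ∀ D, (∀ i, w (D i) ≠ 0) → F D ≤ G D) :
    iidExpect w F ≤ iidExpect w G := by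
  refine Finset.sum_le_sum fun D _ => ?_
  by_cases hD : ∀ i, w (D i) ≠ 0
  · exact mul_le_mul_of_nonneg_left (h D hD) (Finset.prod_nonneg fun i _ => hw _)
  · push Not at hD
    obtain ⟨i, hi⟩ := hD
    rw [Finset.prod_eq_zero (f := fun i => w (D i)) (Finset.mem_univ i) hi, zero_mul, zero_mul]

lemma div_sqrt_le_iidExpect_abs_sum {w f : T → ℝ} (hw₀ : ∀ t, 0 ≤ w t) (hw : ∑ t, w t = 1)
    (hf : ∑ t, w t * f t = 0) (hf₁ : ∀ t, |f t| ≤ 1) :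
    (N * ∑ t, w t * f t ^ 2) / √(1 + 3 * (N * ∑ t, w t * f t ^ 2)) ≤
      iidExpect w fun D : Fin N → T => |∑ i, f (D i)| := by
  set v := ∑ t, w t * f t ^ 2
  set m₁ := iidExpect w fun D : Fin N → T => |∑ i, f (D i)|
  have hprod : ∀ D : Fin N → T, 0 ≤ ∏ i, w (D i) := fun D => Finset.prod_nonneg fun i _ => hw₀ _
  have hv : 0 ≤ v := Finset.sum_nonneg fun t _ => mul_nonneg (hw₀ t) (sq_nonneg _)
  have hm₁ : 0 ≤ m₁ := Finset.sum_nonneg fun D _ => mul_nonneg (hprod D) (abs_nonneg _)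
  have hfour_le : ∑ t, w t * f t ^ 4 ≤ v := by
    refine Finset.sum_le_sum fun t _ => mul_le_mul_of_nonneg_left ?_ (hw₀ t)
    rw [← (show Even 4 by decide).pow_abs, ← sq_abs]
    exact pow_le_pow_of_le_one (abs_nonneg _) (hf₁ t) (by norm_num)
  have hfour : iidExpect w (fun D : Fin N → T => (∑ i, f (D i)) ^ 4) ≤
      N * v * (1 + 3 * (N * v)) := by
    rw [iidExpect_sum_pow_four hw hf]
    have hNv : 0 ≤ (N : ℝ) * v ^ 2 := by positivity
    have hN := mul_le_mul_of_nonneg_left hfour_le N.cast_nonneg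
    linarith
  have hholder : (N * v) ^ 3 ≤ m₁ ^ 2 * (N * v * (1 + 3 * (N * v))) := by
    refine le_trans ?_ (mul_le_mul_of_nonneg_left hfour (sq_nonneg m₁))
    rw [← iidExpect_sum_sq hw hf]
    exact sum_mul_sq_pow_three_le Finset.univ (fun D _ => hprod D) _
  rw [div_le_iff₀ (by positivity), ← Real.sqrt_sq hm₁, ← Real.sqrt_mul (sq_nonneg m₁)]
  refine Real.le_sqrt_of_sq_le ?_
  rcases (show 0 ≤ N * v by positivity).eq_or_lt with hzero | hpos
  · rw [← hzero, zero_pow two_ne_zero]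
    positivity
  · exact le_of_mul_le_mul_left (by linarith) hpos

lemma sum_mul_indicator_sub {w : T → ℝ} (hw : ∑ t, w t = 1) (P : T → Prop) [DecidablePred P] :
    ∑ t, w t * ((if P t then 1 else 0) - ∑ t with P t, w t) = 0 := by
  simp only [mul_sub, Finset.sum_sub_distrib, ← Finset.sum_mul, hw, mul_ite, mul_one, mul_zero,
    Finset.sum_filter, one_mul, sub_self]

lemma sum_mul_indicator_sub_sq {w : T → ℝ} (hw : ∑ t, w t = 1) (P : T → Prop)
    [DecidablePred P] :
    ∑ t, w t * ((if P t then 1 else 0) - ∑ t with P t, w t) ^ 2 =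
      (∑ t with P t, w t) * (1 - ∑ t with P t, w t) := by
  set p := ∑ t with P t, w t with hp
  have hsq : ∀ t, w t * ((if P t then 1 else 0) - p) ^ 2 =
      (1 - 2 * p) * (if P t then w t else 0) + p ^ 2 * w t := fun t => by
    split_ifs <;> ring
  simp only [hsq, Finset.sum_add_distrib, ← Finset.mul_sum, ← Finset.sum_filter, ← hp, hw]
  ring

lemma min_sqrt_div_mul_sqrt_le {p n : ℝ} (hp : 0 ≤ p) (hn : 0 < n) :
    min p √(p / n) * √(1 + 3 * (n * p)) ≤ 2 * p := by
  set m := min p √(p / n)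
  have hm : 0 ≤ m := le_min hp (Real.sqrt_nonneg _)
  have hm_sq : m ^ 2 ≤ p ^ 2 := pow_le_pow_left₀ hm (min_le_left _ _) 2
  have hm_sq' : m ^ 2 ≤ p / n := (Real.le_sqrt hm (by positivity)).1 (min_le_right _ _)
  refine (sq_le_sq₀ (by positivity) (by positivity)).1 ?_
  calc (m * √(1 + 3 * (n * p))) ^ 2 = m ^ 2 + m ^ 2 * (3 * (n * p)) := by
        rw [mul_pow, Real.sq_sqrt (by positivity)]
        ring
    _ ≤ p ^ 2 + p / n * (3 * (n * p)) := by gcongr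
    _ = (2 * p) ^ 2 := by
        field_simp
        ring

lemma min_mul_le_iidExpect_abs_frequency_sub {w : T → ℝ} (hw₀ : ∀ t, 0 ≤ w t)
    (hw : ∑ t, w t = 1) (hN : 0 < N) (P : T → Prop) [DecidablePred P] {p : ℝ}
    (hp : ∑ t with P t, w t = p) :
    (1 - p) / 2 * min p √(p / N) ≤ iidExpect w fun D : Fin N → T =>
      |((Finset.univ.filter fun i => P (D i)).card : ℝ) / N - p| := by
  have hp₀ : 0 ≤ p := hp ▸ Finset.sum_nonneg fun t _ => hw₀ t
  have hp₁ : p ≤ 1 := hp ▸ hw ▸ Finset.sum_le_univ_sum_of_nonneg hw₀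
  have hN' : (0 : ℝ) < N := by exact_mod_cast hN
  have hvar : 0 ≤ p * (1 - p) := mul_nonneg hp₀ (sub_nonneg.2 hp₁)
  have hfreq : ∀ D : Fin N → T, |((Finset.univ.filter fun i => P (D i)).card : ℝ) / N - p| =
      |∑ i, ((if P (D i) then 1 else 0) - p)| * (N : ℝ)⁻¹ := fun D => by
    rw [← abs_of_pos (inv_pos.2 hN'), ← abs_mul]
    simp only [Finset.sum_sub_distrib, Finset.sum_boole, Finset.sum_const, Finset.card_univ,
      Fintype.card_fin, nsmul_eq_mul]
    field_simp
  have hmean := sum_mul_indicator_sub hw P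
  have hsq := sum_mul_indicator_sub_sq hw P
  rw [hp] at hmean hsq
  have hdev := div_sqrt_le_iidExpect_abs_sum (N := N) hw₀ hw hmean
    fun t => by rw [abs_le]; split_ifs <;> constructor <;> linarith
  rw [hsq] at hdev
  simp only [hfreq, iidExpect_mul_const]
  rw [← div_eq_mul_inv, le_div_iff₀ hN']
  refine le_trans ?_ hdev
  rw [le_div_iff₀ (Real.sqrt_pos.2 (by linarith [mul_nonneg hN'.le hvar]))]
  have hmin : 0 ≤ min p √(p / N) := le_min hp₀ (Real.sqrt_nonneg _)
  have hfactor : 0 ≤ N * ((1 - p) / 2) := mul_nonneg hN'.le (by linarith)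
  have hsqrt : √(1 + 3 * (N * (p * (1 - p)))) ≤ √(1 + 3 * (N * p)) := by
    gcongr
    exact mul_le_of_le_one_right hp₀ (by linarith)
  calc (1 - p) / 2 * min p √(p / N) * N * √(1 + 3 * (N * (p * (1 - p))))
      = N * ((1 - p) / 2) * (min p √(p / N) * √(1 + 3 * (N * (p * (1 - p))))) := by ring
    _ ≤ N * ((1 - p) / 2) * (min p √(p / N) * √(1 + 3 * (N * p))) :=
        mul_le_mul_of_nonneg_left (mul_le_mul_of_nonneg_left hsqrt hmin) hfactor
    _ ≤ N * ((1 - p) / 2) * (2 * p) :=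
        mul_le_mul_of_nonneg_left (min_sqrt_div_mul_sqrt_le hp₀ hN') hfactor
    _ = N * (p * (1 - p)) := by ring

end Sampling

section UniformMeasure

variable {E : Type*} [NormedAddCommGroup E] [NormedSpace ℝ E] [FiniteDimensional ℝ E]
  [MeasurableSpace E] [BorelSpace E] {K : Set E}

lemma hausdorffMeasure_dimH_ne_zero_ne_top_of_interior (hK : IsCompact K)
    (hint : (interior K).Nonempty) :
    Measure.hausdorffMeasure (dimH K).toReal K ≠ 0 ∧
      Measure.hausdorffMeasure (dimH K).toReal K ≠ ⊤ := by
  have hdim : (dimH K).toReal = Module.finrank ℝ E := by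
    rw [Real.dimH_of_nonempty_interior hint, ENNReal.toReal_natCast]
  rw [hdim]
  exact ⟨fun h => (isOpen_interior.measure_pos _ hint).ne' (measure_mono_null interior_subset h),
    hK.measure_lt_top.ne⟩

lemma hausdorffMeasure_dimH_ne_zero_ne_top (hK : IsCompact K) (hc : Convex ℝ K) (hne : K.Nonempty) :
    Measure.hausdorffMeasure (dimH K).toReal K ≠ 0 ∧
      Measure.hausdorffMeasure (dimH K).toReal K ≠ ⊤ := by
  obtain ⟨_, y, hy, -⟩ := hne.intrinsicInterior hc
  have : Nonempty (affineSpan ℝ K) := ⟨y⟩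
  -- `K` has nonempty interior in its affine span, which is isometric to a normed space.
  let e : (affineSpan ℝ K).direction ≃ᵢ affineSpan ℝ K := IsometryEquiv.vaddConst y
  let f : (affineSpan ℝ K).direction → E := fun v => e v
  have hf : Isometry f := isometry_subtype_coe.comp e.isometry
  have himage : f '' (f ⁻¹' K) = K := by
    refine Set.image_preimage_eq_of_subset fun x hx => ?_
    exact ⟨e.symm ⟨x, subset_affineSpan ℝ K hx⟩, by simp [f]⟩
  have hcompact : IsCompact (f ⁻¹' K) := hf.isClosedEmbedding.isCompact_preimage hK
  have hint : (interior (f ⁻¹' K)).Nonempty := by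
    refine ⟨e.symm y, ?_⟩
    have hpreimage : f ⁻¹' K = e ⁻¹' ((↑) ⁻¹' K) := rfl
    rw [hpreimage, ← e.coe_toHomeomorph, ← e.toHomeomorph.preimage_interior]
    simpa using hy
  have h := hausdorffMeasure_dimH_ne_zero_ne_top_of_interior hcompact hint
  rwa [← hf.dimH_image, ← hf.hausdorffMeasure_image (Or.inl ENNReal.toReal_nonneg), himage] at h

lemma isProbabilityMeasure_uniformMeasure (hK : IsCompact K) (hc : Convex ℝ K)
    (hne : K.Nonempty) : IsProbabilityMeasure (uniformMeasure K) :=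
  have h := hausdorffMeasure_dimH_ne_zero_ne_top hK hc hne
  ProbabilityTheory.cond_isProbabilityMeasure_of_finite h.1 h.2

lemma integrable_uniformMeasure {F : Type*} [NormedAddCommGroup F] (hK : IsCompact K)
    (hc : Convex ℝ K) (hne : K.Nonempty) {f : E → F} (hf : ContinuousOn f K) :
    Integrable f (uniformMeasure K) := by
  have := isProbabilityMeasure_uniformMeasure hK hc hne
  obtain ⟨C, hC⟩ := hK.exists_bound_of_continuousOn hf
  refine Integrable.of_bound ?_ C
    ((ProbabilityTheory.ae_cond_mem hK.measurableSet).mono fun x hx => hC x hx)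
  exact (hf.aestronglyMeasurable_of_isCompact hK hK.measurableSet).smul_measure _

lemma measurePreserving_uniformMeasure {X : Type*} [EMetricSpace X] [MeasurableSpace X]
    [BorelSpace X] {L : Set X} (hL : MeasurableSet L) (e : X ≃ᵢ X) (he : e ⁻¹' L = L) :
    MeasurePreserving e (uniformMeasure L) (uniformMeasure L) := by
  have h := (e.measurePreserving_hausdorffMeasure (dimH L).toReal).restrict_preimage hL
  rw [he] at h
  exact h.smul_measure _

end UniformMeasure

section Reflection

variable {ι : Type*} [Fintype ι] [DecidableEq ι] {i j : ι}

/-- The reflection of Euclidean space in the hyperplane `x i - x j = t`, for `i ≠ j`: it exchanges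
the coordinates `i` and `j` and then adds `t` to the former and `-t` to the latter. -/
noncomputable def coordReflection (i j : ι) (t : ℝ) : EuclideanSpace ℝ ι ≃ᵢ EuclideanSpace ℝ ι :=
  (LinearIsometryEquiv.piLpCongrLeft 2 ℝ ℝ (Equiv.swap i j)).toIsometryEquiv.trans
    (IsometryEquiv.addRight (EuclideanSpace.single i t - EuclideanSpace.single j t))

lemma coordReflection_apply (hij : i ≠ j) (t : ℝ) (x : EuclideanSpace ℝ ι) (k : ι) :
    coordReflection i j t x k = x k + (if k = i then x j + t - x i else 0) -
      if k = j then x j + t - x i else 0 := by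
  have h : coordReflection i j t x k =
      x (Equiv.swap i j k) + ((if k = i then t else 0) - if k = j then t else 0) := by
    simp [coordReflection, LinearIsometryEquiv.piLpCongrLeft_apply, Equiv.piCongrLeft']
  rw [h, Equiv.swap_apply_def]
  grind

lemma coordReflection_coordReflection (hij : i ≠ j) (t : ℝ) (x : EuclideanSpace ℝ ι) :
    coordReflection i j t (coordReflection i j t x) = x := by
  ext k
  simp only [coordReflection_apply hij]
  grind

lemma integral_uniformMeasure_apply_le {K : Set (EuclideanSpace ℝ ι)} (hK : IsCompact K)
    (hc : Convex ℝ K) (hne : K.Nonempty) (hij : i ≠ j) {t c : ℝ}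
    (hrefl : ∀ x ∈ K, coordReflection i j t x ∈ K) (hle : ∀ x ∈ K, x i + x j ≤ c) :
    ∫ x, x i ∂uniformMeasure K ≤ (c + t) / 2 := by
  have := isProbabilityMeasure_uniformMeasure hK hc hne
  have hint : ∀ k, Integrable (fun x : EuclideanSpace ℝ ι => x k) (uniformMeasure K) := fun k =>
    integrable_uniformMeasure hK hc hne (by fun_prop)
  have hpreimage : coordReflection i j t ⁻¹' K = K := Set.Subset.antisymm
    (fun x hx => coordReflection_coordReflection hij t x ▸ hrefl _ hx) hrefl
  have hsymm : ∫ x, x i ∂uniformMeasure K = ∫ x, x j ∂uniformMeasure K + t := by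
    have hpres := measurePreserving_uniformMeasure hK.measurableSet _ hpreimage
    rw [← hpres.integral_comp (coordReflection i j t).toHomeomorph.measurableEmbedding]
    simp [coordReflection_apply hij, hij, integral_add (hint j) (integrable_const t)]
  have hsum : ∫ x, x i ∂uniformMeasure K + ∫ x, x j ∂uniformMeasure K ≤ c := by
    rw [← integral_add (hint i) (hint j)]
    calc ∫ x, (x i + x j) ∂uniformMeasure K ≤ ∫ _, c ∂uniformMeasure K :=
          integral_mono_ae ((hint i).add (hint j)) (integrable_const c)
            ((ProbabilityTheory.ae_cond_mem hK.measurableSet).mono hle)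
      _ = c := by simp
  linarith

end Reflection

section Policies

variable {S A : Type*} {H : ℕ}

section Fintype

variable [Fintype A]

lemma isCompact_policies : IsCompact (policies S A H) := by
  have hcompact := isCompact_univ_pi fun _ : Fin H × S => isCompact_stdSimplex ℝ A
  let f : (Fin H × S → A → ℝ) → PolicySpace S A H := fun x =>
    WithLp.toLp 2 fun k => x (k.1, k.2.1) k.2.2
  convert hcompact.image (f := f) (by fun_prop) using 1
  ext π
  refine ⟨fun hπ => ⟨fun p a => π (p.1, p.2, a), fun p _ => hπ p.1 p.2, rfl⟩, ?_⟩
  rintro ⟨x, hx, rfl⟩ h s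
  exact hx (h, s) (Set.mem_univ _)

lemma convex_policies : Convex ℝ (policies S A H) :=
  fun _ hπ _ hπ' _ _ ha hb hab h s => convex_stdSimplex ℝ A (hπ h s) (hπ' h s) ha hb hab

lemma policies_apply_add_apply_le_one {π : PolicySpace S A H} (hπ : π ∈ policies S A H) (h : Fin H)
    (s : S) {a a' : A} (ha : a ≠ a') : π (h, s, a) + π (h, s, a') ≤ 1 := by
  classical
  rw [← Finset.sum_pair (f := fun x => π (h, s, x)) ha, ← (hπ h s).2]
  exact Finset.sum_le_univ_sum_of_nonneg (hπ h s).1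

lemma policies_apply_eq_zero {π : PolicySpace S A H} (hπ : π ∈ policies S A H) {h : Fin H}
    {s : S} {a a' : A} (ha : π (h, s, a) = 1) (hne : a' ≠ a) : π (h, s, a') = 0 :=
  le_antisymm (by linarith [policies_apply_add_apply_le_one hπ h s hne.symm]) ((hπ h s).1 a')

end Fintype

variable [DecidableEq A]

/-- The policy that always plays the action `a`. -/
noncomputable def constPolicy (S : Type*) (H : ℕ) (a : A) : PolicySpace S A H :=
  WithLp.toLp 2 fun k => if k.2.2 = a then 1 else 0

@[simp]
lemma constPolicy_apply (a a' : A) (h : Fin H) (s : S) :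
    constPolicy S H a (h, s, a') = if a' = a then 1 else 0 :=
  rfl

variable [Fintype A]

lemma constPolicy_mem_policies (a : A) : constPolicy S H a ∈ policies S A H :=
  fun _ _ => ⟨fun a' => by simp only [constPolicy_apply]; split_ifs <;> norm_num, by simp⟩

/-- The policies that play `a` with probability at least `t h s` at step `h` in state `s`. -/
def thresholdPolicies (a : A) (t : Fin H → S → ℝ) : Set (PolicySpace S A H) :=
  {π | π ∈ policies S A H ∧ ∀ h s, t h s ≤ π (h, s, a)}

lemma coordReflection_mem_thresholdPolicies [Fintype S] [DecidableEq S] {a a' : A} (ha : a ≠ a')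
    {t : Fin H → S → ℝ} {h : Fin H} {s : S} (ht : 0 ≤ t h s) {π : PolicySpace S A H}
    (hπ : π ∈ thresholdPolicies a t) :
    coordReflection (h, s, a) (h, s, a') (t h s) π ∈ thresholdPolicies a t := by
  have hne : (h, s, a) ≠ (h, s, a') := by simpa using ha
  have hπ₀ := (hπ.1 h s).1 a'
  have hπt := hπ.2 h s
  refine ⟨fun h' s' => ⟨fun b => ?_, ?_⟩, fun h' s' => ?_⟩
  · have hb := (hπ.1 h' s').1 b
    simp only [coordReflection_apply hne]
    grind
  · simp only [coordReflection_apply hne, Finset.sum_sub_distrib, Finset.sum_add_distrib,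
      (hπ.1 h' s').2, Prod.mk.injEq, ← and_assoc, ite_and _ (_ = _ : Prop)]
    simp
  · have hb := hπ.2 h' s'
    rw [coordReflection_apply hne]
    grind

end Policies

namespace EpisodicMDP

section Absorbing

variable {S A : Type*} [Fintype S] {H N : ℕ}

lemma continuous_trajProb (M : EpisodicMDP S A H) (tr : Trajectory S A H) :
    Continuous fun π : PolicySpace S A H => M.trajProb π tr := by
  unfold trajProb
  fun_prop

lemma continuous_value [Fintype A] (M : EpisodicMDP S A H) : Continuous M.value :=
  continuous_finsetSum _ fun tr _ => (M.continuous_trajProb tr).mul_const _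

lemma trajProb_nonneg [Fintype A] (M : EpisodicMDP S A H) {π : PolicySpace S A H}
    (hπ : π ∈ policies S A H) (tr : Trajectory S A H) : 0 ≤ M.trajProb π tr := by
  refine Finset.prod_nonneg fun h _ => mul_nonneg ?_ ((hπ _ _).1 _)
  split_ifs
  · exact M.ρ_mem.1 _
  · exact (M.P_mem _ _ _).1 _

/-- Every action keeps every state in place. -/
def IsAbsorbing (M : EpisodicMDP S A H) : Prop :=
  ∀ h s a, M.P h s a s = 1

variable {M : EpisodicMDP S A H}

lemma IsAbsorbing.transition_eq_zero (hM : M.IsAbsorbing) (h : Fin H) {s s' : S} (a : A)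
    (hne : s' ≠ s) : M.P h s a s' = 0 := by
  classical
  have hpair := Finset.sum_le_univ_sum_of_nonneg (s := {s, s'}) (M.P_mem h s a).1
  rw [Finset.sum_pair hne.symm, hM h s a, (M.P_mem h s a).2] at hpair
  exact le_antisymm (by linarith) ((M.P_mem h s a).1 s')

lemma IsAbsorbing.fst_eq_of_trajProb_ne_zero (hM : M.IsAbsorbing) {π : PolicySpace S A H}
    {tr : Trajectory S A H} (htr : M.trajProb π tr ≠ 0) (h k : Fin H) :
    (tr h).1 = (tr k).1 := by
  obtain ⟨n, rfl⟩ : ∃ n, H = n + 1 := Nat.exists_eq_succ_of_ne_zero h.pos.ne'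
  suffices hzero : ∀ h, (tr h).1 = (tr 0).1 from (hzero h).trans (hzero k).symm
  intro h
  induction h using Fin.induction with
  | zero => rfl
  | succ i ih =>
    rw [← ih]
    by_contra hne
    refine left_ne_zero_of_mul (Finset.prod_ne_zero_iff.1 htr i.succ (Finset.mem_univ _)) ?_
    rw [if_neg (by simp)]
    exact hM.transition_eq_zero _ _ hne

lemma IsAbsorbing.trajProb_eq_mul_prod {n : ℕ} {M : EpisodicMDP S A (n + 1)} (hM : M.IsAbsorbing)
    (π : PolicySpace S A (n + 1)) {tr : Trajectory S A (n + 1)} {s : S}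
    (htr : ∀ h, (tr h).1 = s) : M.trajProb π tr = M.ρ s * ∏ h, π (h, s, (tr h).2) := by
  rw [trajProb, Finset.prod_mul_distrib, Fin.prod_univ_succ]
  simp [htr, hM _ s]

lemma IsAbsorbing.trajProb_eq_sum [DecidableEq S] (hM : M.IsAbsorbing) (π : PolicySpace S A H)
    (tr : Trajectory S A H) : M.trajProb π tr =
      ∑ s, M.ρ s * ∏ h, if (tr h).1 = s then π (h, s, (tr h).2) else 0 := by
  rcases H with _ | n
  · simp [trajProb, M.ρ_mem.2]
  by_cases hconst : ∀ h, (tr h).1 = (tr 0).1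
  · rw [hM.trajProb_eq_mul_prod π hconst, Finset.sum_eq_single (tr 0).1]
    · simp only [hconst, if_true]
    · intro s _ hs
      rw [Finset.prod_eq_zero (Finset.mem_univ 0) (by simp [hs.symm]), mul_zero]
    · simp
  · have hzero : M.trajProb π tr = 0 := by
      by_contra htr
      exact hconst fun h => hM.fst_eq_of_trajProb_ne_zero htr h 0
    rw [hzero, Finset.sum_eq_zero]
    intro s _
    obtain ⟨h, hh⟩ : ∃ h, (tr h).1 ≠ s := by
      by_contra! hall
      exact hconst fun h => (hall h).trans (hall 0).symm
    rw [Finset.prod_eq_zero (Finset.mem_univ h) (by simp [hh]), mul_zero]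

variable [Fintype A] {π : PolicySpace S A H}

lemma sum_ite_fst_eq [DecidableEq S] (hπ : π ∈ policies S A H) (h : Fin H) (s : S) :
    ∑ x : S × A, (if x.1 = s then π (h, s, x.2) else 0) = 1 := by
  rw [Fintype.sum_prod_type, Finset.sum_eq_single s (by simp +contextual) (by simp)]
  simpa using (hπ h s).2

lemma IsAbsorbing.sum_trajProb (hM : M.IsAbsorbing) (hπ : π ∈ policies S A H) :
    ∑ tr, M.trajProb π tr = 1 := by
  classical
  simp only [hM.trajProb_eq_sum]
  rw [Finset.sum_comm]
  refine (Finset.sum_congr rfl fun s _ => ?_).trans M.ρ_mem.2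
  rw [← Finset.mul_sum,
    ← Fintype.prod_sum fun k (x : S × A) => if x.1 = s then π (k, s, x.2) else 0]
  simp only [sum_ite_fst_eq hπ, Finset.prod_const_one, mul_one]

variable [DecidableEq S] [DecidableEq A]

lemma value_eq_sum_occupancy (M : EpisodicMDP S A H) (π : PolicySpace S A H) :
    M.value π = ∑ h, ∑ s, ∑ a, M.occupancy π h s a * M.r h s a := by
  simp only [value, occupancy, Finset.mul_sum, Finset.sum_mul]
  rw [Finset.sum_comm]
  refine Finset.sum_congr rfl fun h _ => ?_
  rw [← Fintype.sum_prod_type' fun s a => ∑ tr : Trajectory S A H,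
    (if tr h = (s, a) then M.trajProb π tr else 0) * M.r h s a, Finset.sum_comm]
  simp

lemma IsAbsorbing.occupancy_eq (hM : M.IsAbsorbing) (hπ : π ∈ policies S A H) (h : Fin H) (s : S)
    (a : A) : M.occupancy π h s a = M.ρ s * π (h, s, a) := by
  rw [occupancy, ← Finset.sum_filter]
  simp only [hM.trajProb_eq_sum]
  rw [Finset.sum_comm]
  have hmarginal : ∀ s', ∑ tr : Trajectory S A H with tr h = (s, a),
      ∏ k, (if (tr k).1 = s' then π (k, s', (tr k).2) else 0) =
        if s = s' then π (h, s', a) else 0 :=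
    fun s' => sum_filter_prod_eq (f := fun k x => if x.1 = s' then π (k, s', x.2) else 0)
      (fun k _ => sum_ite_fst_eq hπ k s') (s, a)
  simp only [← Finset.mul_sum, hmarginal]
  simp

lemma continuous_tvLoss (M : EpisodicMDP S A H) (D : Fin N → Trajectory S A H) :
    Continuous (M.tvLoss D) := by
  unfold tvLoss occupancy
  simp only [← Finset.sum_filter]
  have := M.continuous_trajProb
  fun_prop

lemma IsAbsorbing.convexOn_tvLoss (hM : M.IsAbsorbing) (D : Fin N → Trajectory S A H) :
    ConvexOn ℝ (policies S A H) (M.tvLoss D) := by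
  refine ⟨convex_policies, fun π hπ π' hπ' a b ha hb hab => ?_⟩
  simp only [tvLoss, smul_eq_mul, Finset.mul_sum, ← Finset.sum_add_distrib]
  refine Finset.sum_le_sum fun h _ => Finset.sum_le_sum fun s _ => Finset.sum_le_sum fun c _ => ?_
  rw [hM.occupancy_eq hπ, hM.occupancy_eq hπ', hM.occupancy_eq (convex_policies hπ hπ' ha hb hab)]
  refine le_of_eq_of_le (congrArg _ ?_) <| (convexOn_univ_norm (E := ℝ)).2
    (Set.mem_univ (M.ρ s * π (h, s, c) - empirical D h s c))
    (Set.mem_univ (M.ρ s * π' (h, s, c) - empirical D h s c)) ha hb hab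
  simp only [PiLp.add_apply, PiLp.smul_apply, smul_eq_mul]
  linear_combination empirical D h s c * hab

lemma isCompact_tvAIL (M : EpisodicMDP S A H) (D : Fin N → Trajectory S A H) :
    IsCompact (M.tvAIL D) := by
  have hinter : M.tvAIL D =
      policies S A H ∩ ⋂ π' ∈ policies S A H, {π | M.tvLoss D π ≤ M.tvLoss D π'} := by
    ext π
    simp [tvAIL]
  rw [hinter]
  exact isCompact_policies.inter_right <| isClosed_biInter fun π' _ =>
    isClosed_le (M.continuous_tvLoss D) continuous_const

lemma nonempty_tvAIL [Nonempty A] (M : EpisodicMDP S A H) (D : Fin N → Trajectory S A H) :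
    (M.tvAIL D).Nonempty :=
  isCompact_policies.exists_isMinOn ⟨_, constPolicy_mem_policies (Classical.arbitrary A)⟩
    (M.continuous_tvLoss D).continuousOn

lemma IsAbsorbing.convex_tvAIL (hM : M.IsAbsorbing) (D : Fin N → Trajectory S A H) :
    Convex ℝ (M.tvAIL D) := fun _ hπ _ hπ' _ _ ha hb hab =>
  ⟨convex_policies hπ.1 hπ'.1 ha hb hab, fun π₀ hπ₀ => ((hM.convexOn_tvLoss D).convex_le
    (M.tvLoss D π₀) ⟨hπ.1, hπ.2 π₀ hπ₀⟩ ⟨hπ'.1, hπ'.2 π₀ hπ₀⟩ ha hb hab).2⟩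

variable [Nonempty A]

lemma IsAbsorbing.isProbabilityMeasure_tvAILLaw (hM : M.IsAbsorbing)
    (D : Fin N → Trajectory S A H) : IsProbabilityMeasure (M.tvAILLaw D) :=
  isProbabilityMeasure_uniformMeasure (M.isCompact_tvAIL D) (hM.convex_tvAIL D)
    (M.nonempty_tvAIL D)

lemma IsAbsorbing.integrable_tvAILLaw (hM : M.IsAbsorbing) (D : Fin N → Trajectory S A H)
    {f : PolicySpace S A H → ℝ} (hf : Continuous f) : Integrable f (M.tvAILLaw D) :=
  integrable_uniformMeasure (M.isCompact_tvAIL D) (hM.convex_tvAIL D) (M.nonempty_tvAIL D)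
    hf.continuousOn

end Absorbing

end EpisodicMDP

section Empirical

variable {S A : Type*} [DecidableEq S] [DecidableEq A] {H N : ℕ}

lemma empirical_nonneg (D : Fin N → Trajectory S A H) (h : Fin H) (s : S) (a : A) :
    0 ≤ empirical D h s a := by
  unfold empirical
  positivity

lemma empirical_eq_zero {D : Fin N → Trajectory S A H} {h : Fin H} {a : A}
    (hD : ∀ i, (D i h).2 ≠ a) (s : S) : empirical D h s a = 0 := by
  have hempty : (Finset.univ.filter fun i => D i h = (s, a)) = ∅ :=
    Finset.filter_eq_empty_iff.2 fun i _ hi => hD i (by rw [hi])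
  rw [empirical, hempty, Finset.card_empty, Nat.cast_zero, zero_div]

lemma sum_empirical_of_forall_snd_eq [Fintype S] (hN : 0 < N) {D : Fin N → Trajectory S A H}
    {h : Fin H} {a : A} (hD : ∀ i, (D i h).2 = a) : ∑ s, empirical D h s a = 1 := by
  simp only [empirical, Prod.ext_iff, hD, and_true]
  rw [← Finset.sum_div, div_eq_one_iff_eq (by positivity), ← Nat.cast_sum,
    Finset.sum_card_fiberwise_eq_card_filter]
  simp

end Empirical

section SingleAction

lemma abs_sub_le_abs_mul_sub_add {ρ x : ℝ} (hρ : 0 ≤ ρ) (hx : x ≤ 1) (q : ℝ) :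
    |ρ - q| ≤ |ρ * x - q| + ρ * (1 - x) := by
  have h := abs_add_le (ρ * x - q) (ρ * (1 - x))
  rwa [abs_of_nonneg (mul_nonneg hρ (sub_nonneg.2 hx)),
    show ρ * x - q + ρ * (1 - x) = ρ - q by ring] at h

-- If `ρ = 0`, both sides hold since `q / 0 = 0`.
lemma abs_sub_eq_abs_mul_sub_add_iff {ρ q x : ℝ} (hρ : 0 ≤ ρ) (hx₀ : 0 ≤ x) (hx₁ : x ≤ 1) :
    |ρ - q| = |ρ * x - q| + ρ * (1 - x) ↔ min (q / ρ) 1 ≤ x := by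
  rcases hρ.eq_or_lt with rfl | hρ
  · simp [hx₀]
  rw [min_le_iff, div_le_iff₀ hρ]
  refine ⟨fun h => ?_, ?_⟩
  · by_contra! hlt
    have hmul : ρ * x < ρ := mul_lt_of_lt_one_right hρ hlt.2
    rw [abs_of_neg (show ρ * x - q < 0 by linarith)] at h
    cases abs_cases (ρ - q) <;> linarith
  · rintro (h | h)
    · have hmul : ρ * x ≤ ρ := mul_le_of_le_one_right hρ.le hx₁
      rw [abs_of_nonneg (by linarith), abs_of_nonneg (by linarith)]
      ring
    · simp [le_antisymm hx₁ h]

lemma mul_min_div_one_le {ρ q : ℝ} (hρ : 0 ≤ ρ) (hq : 0 ≤ q) :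
    ρ * min (q / ρ) 1 ≤ (ρ + q - |ρ - q|) / 2 := by
  have hmin : ρ * min (q / ρ) 1 ≤ min q ρ := by
    rcases hρ.eq_or_lt with rfl | hρ
    · simp [hq]
    · rw [mul_min_of_nonneg _ _ hρ.le, mul_one, mul_div_cancel₀ _ hρ.ne']
  cases abs_cases (ρ - q) <;> cases min_cases q ρ <;> linarith

namespace EpisodicMDP

variable {S A : Type*} [Fintype S] [Fintype A] [DecidableEq S] [DecidableEq A] {H N : ℕ}
  {M : EpisodicMDP S A H} {π : PolicySpace S A H} {D : Fin N → Trajectory S A H} {a₁ a₂ : A}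

lemma IsAbsorbing.tvLoss_eq (hM : M.IsAbsorbing) (hD : ∀ i h, (D i h).2 = a₁)
    (hπ : π ∈ policies S A H) :
    M.tvLoss D π = ∑ h, ∑ s,
      (|M.ρ s * π (h, s, a₁) - empirical D h s a₁| + M.ρ s * (1 - π (h, s, a₁))) := by
  refine Finset.sum_congr rfl fun h _ => Finset.sum_congr rfl fun s _ => ?_
  rw [← Finset.add_sum_erase _ _ (Finset.mem_univ a₁), hM.occupancy_eq hπ, ← (hπ h s).2,
    ← Finset.add_sum_erase _ (fun a => π (h, s, a)) (Finset.mem_univ a₁), add_sub_cancel_left,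
    Finset.mul_sum]
  congr 1
  refine Finset.sum_congr rfl fun a ha => ?_
  rw [hM.occupancy_eq hπ,
    empirical_eq_zero (fun i => hD i h ▸ (Finset.ne_of_mem_erase ha).symm), sub_zero,
    abs_of_nonneg (mul_nonneg (M.ρ_mem.1 s) ((hπ h s).1 a))]

lemma IsAbsorbing.tvLoss_constPolicy (hM : M.IsAbsorbing) (hD : ∀ i h, (D i h).2 = a₁) :
    M.tvLoss D (constPolicy S H a₁) = ∑ h, ∑ s, |M.ρ s - empirical D h s a₁| := by
  simp [hM.tvLoss_eq hD (constPolicy_mem_policies a₁)]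

lemma IsAbsorbing.tvAIL_eq (hM : M.IsAbsorbing) (hD : ∀ i h, (D i h).2 = a₁) :
    M.tvAIL D = thresholdPolicies a₁ fun h s => min (empirical D h s a₁ / M.ρ s) 1 := by
  have hterm : ∀ π ∈ policies S A H, ∀ h s, |M.ρ s - empirical D h s a₁| ≤
      |M.ρ s * π (h, s, a₁) - empirical D h s a₁| + M.ρ s * (1 - π (h, s, a₁)) :=
    fun π hπ h s => abs_sub_le_abs_mul_sub_add (M.ρ_mem.1 s)
      (mem_Icc_of_mem_stdSimplex (hπ h s) a₁).2 _
  have hle : ∀ π ∈ policies S A H, M.tvLoss D (constPolicy S H a₁) ≤ M.tvLoss D π := by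
    intro π hπ
    rw [hM.tvLoss_constPolicy hD, hM.tvLoss_eq hD hπ]
    exact Finset.sum_le_sum fun h _ => Finset.sum_le_sum fun s _ => hterm π hπ h s
  ext π
  refine and_congr_right fun hπ => ?_
  have hmin : (∀ π' ∈ policies S A H, M.tvLoss D π ≤ M.tvLoss D π') ↔
      M.tvLoss D (constPolicy S H a₁) = M.tvLoss D π :=
    ⟨fun h => le_antisymm (hle π hπ) (h _ (constPolicy_mem_policies a₁)), fun h => h ▸ hle⟩
  rw [hmin, hM.tvLoss_constPolicy hD, hM.tvLoss_eq hD hπ, Finset.sum_eq_sum_iff_of_le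
    fun h _ => Finset.sum_le_sum fun s _ => hterm π hπ h s]
  simp only [Finset.mem_univ, forall_const]
  refine forall_congr' fun h => ?_
  rw [Finset.sum_eq_sum_iff_of_le fun s _ => hterm π hπ h s]
  simp only [Finset.mem_univ, forall_const]
  have hIcc := fun s => mem_Icc_of_mem_stdSimplex (hπ h s) a₁
  exact forall_congr' fun s =>
    abs_sub_eq_abs_mul_sub_add_iff (M.ρ_mem.1 s) (hIcc s).1 (hIcc s).2

lemma IsAbsorbing.mul_integral_apply_le (hM : M.IsAbsorbing) (ha : a₁ ≠ a₂)
    (hD : ∀ i h, (D i h).2 = a₁) (h : Fin H) (s : S) :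
    M.ρ s * ∫ π, π (h, s, a₁) ∂M.tvAILLaw D ≤
      M.ρ s / 2 + (M.ρ s + empirical D h s a₁ - |M.ρ s - empirical D h s a₁|) / 4 := by
  have : Nonempty A := ⟨a₁⟩
  have hρ := M.ρ_mem.1 s
  have hq := empirical_nonneg D h s a₁
  have hthreshold : 0 ≤ min (empirical D h s a₁ / M.ρ s) 1 :=
    le_min (div_nonneg hq hρ) zero_le_one
  have hmean := integral_uniformMeasure_apply_le (M.isCompact_tvAIL D) (hM.convex_tvAIL D)
    (M.nonempty_tvAIL D) (i := (h, s, a₁)) (j := (h, s, a₂)) (by simpa using ha)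
    (fun π hπ => by
      rw [hM.tvAIL_eq hD] at hπ ⊢
      exact coordReflection_mem_thresholdPolicies ha hthreshold hπ)
    fun π hπ => policies_apply_add_apply_le_one hπ.1 h s ha
  have hmul := mul_le_mul_of_nonneg_left hmean hρ
  have hmin := mul_min_div_one_le hρ hq
  rw [tvAILLaw]
  linarith

omit [DecidableEq S] in
lemma IsAbsorbing.value_eq (hM : M.IsAbsorbing)
    (hr : ∀ h s a, M.r h s a = if a = a₁ then 1 else 0) (hπ : π ∈ policies S A H) :
    M.value π = ∑ h, ∑ s, M.ρ s * π (h, s, a₁) := by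
  classical
  simp [value_eq_sum_occupancy, hM.occupancy_eq hπ, hr]

omit [DecidableEq S] in
lemma IsAbsorbing.value_constPolicy (hM : M.IsAbsorbing)
    (hr : ∀ h s a, M.r h s a = if a = a₁ then 1 else 0) :
    M.value (constPolicy S H a₁) = H := by
  simp [hM.value_eq hr (constPolicy_mem_policies a₁), M.ρ_mem.2]

lemma IsAbsorbing.integral_value_tvAILLaw_le (hM : M.IsAbsorbing) (ha : a₁ ≠ a₂)
    (hr : ∀ h s a, M.r h s a = if a = a₁ then 1 else 0) (hN : 0 < N)
    (hD : ∀ i h, (D i h).2 = a₁) :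
    ∫ π, M.value π ∂M.tvAILLaw D ≤
      M.value (constPolicy S H a₁) - M.tvLoss D (constPolicy S H a₁) / 4 := by
  have : Nonempty A := ⟨a₁⟩
  have hint : ∀ h s, Integrable (fun π : PolicySpace S A H => M.ρ s * π (h, s, a₁))
      (M.tvAILLaw D) := fun h s => hM.integrable_tvAILLaw D (by fun_prop)
  have hvalue : ∫ π, M.value π ∂M.tvAILLaw D =
      ∫ π, ∑ h, ∑ s, M.ρ s * π (h, s, a₁) ∂M.tvAILLaw D := integral_congr_ae <|
    (ProbabilityTheory.ae_cond_mem (M.isCompact_tvAIL D).measurableSet).mono fun π hπ =>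
      hM.value_eq hr hπ.1
  rw [hvalue, integral_finsetSum _ fun h _ => integrable_finsetSum _ fun s _ => hint h s]
  simp only [integral_finsetSum _ fun s _ => hint _ s, integral_const_mul]
  calc ∑ h, ∑ s, M.ρ s * ∫ π, π (h, s, a₁) ∂M.tvAILLaw D
      ≤ ∑ h, ∑ s, (M.ρ s / 2 +
          (M.ρ s + empirical D h s a₁ - |M.ρ s - empirical D h s a₁|) / 4) :=
        Finset.sum_le_sum fun h _ => Finset.sum_le_sum fun s _ =>
          hM.mul_integral_apply_le ha hD h s
    _ = ∑ h : Fin H, (1 - (∑ s, |M.ρ s - empirical D h s a₁|) / 4) := by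
        refine Finset.sum_congr rfl fun h _ => ?_
        rw [Finset.sum_add_distrib, ← Finset.sum_div, ← Finset.sum_div, Finset.sum_sub_distrib,
          Finset.sum_add_distrib, M.ρ_mem.2, sum_empirical_of_forall_snd_eq hN fun i => hD i h]
        ring
    _ = M.value (constPolicy S H a₁) - M.tvLoss D (constPolicy S H a₁) / 4 := by
        rw [hM.value_constPolicy hr, hM.tvLoss_constPolicy hD, Finset.sum_sub_distrib,
          ← Finset.sum_div]
        simp

end EpisodicMDP

end SingleAction

namespace EpisodicMDP

variable {S A : Type*} [Fintype S] [Fintype A] [DecidableEq S] [DecidableEq A] {H N : ℕ}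
  {M : EpisodicMDP S A H} {π : PolicySpace S A H} {a₁ a₂ : A}

omit [Fintype A] [DecidableEq S] in
lemma snd_eq_of_trajProb_constPolicy_ne_zero {tr : Trajectory S A H}
    (htr : M.trajProb (constPolicy S H a₁) tr ≠ 0) (h : Fin H) : (tr h).2 = a₁ := by
  by_contra hne
  exact right_ne_zero_of_mul (Finset.prod_ne_zero_iff.1 htr h (Finset.mem_univ h)) (if_neg hne)

lemma expectedAILValue_eq_iidExpect (M : EpisodicMDP S A H) (π : PolicySpace S A H) (N : ℕ) :
    M.expectedAILValue π N =
      iidExpect (M.trajProb π) fun D : Fin N → Trajectory S A H => ∫ π', M.value π' ∂M.tvAILLaw D :=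
  rfl

lemma IsAbsorbing.le_iidExpect_tvLoss (hM : M.IsAbsorbing) (hπ : π ∈ policies S A H)
    (hN : 0 < N) :
    ∑ h, ∑ s, ∑ a, (1 - M.occupancy π h s a) / 2 *
        min (M.occupancy π h s a) √(M.occupancy π h s a / N) ≤
      iidExpect (M.trajProb π) fun D : Fin N → Trajectory S A H => M.tvLoss D π := by
  simp only [tvLoss, iidExpect_finsetSum]
  refine Finset.sum_le_sum fun h _ => Finset.sum_le_sum fun s _ => Finset.sum_le_sum fun a _ => ?_
  simp only [abs_sub_comm (M.occupancy π h s a)]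
  exact min_mul_le_iidExpect_abs_frequency_sub (M.trajProb_nonneg hπ) (hM.sum_trajProb hπ) hN
    (fun tr => tr h = (s, a)) (Finset.sum_filter _ _)

lemma IsAbsorbing.iidExpect_tvLoss_div_four_le (hM : M.IsAbsorbing) (ha : a₁ ≠ a₂)
    (hr : ∀ h s a, M.r h s a = if a = a₁ then 1 else 0) (hN : 0 < N) :
    (iidExpect (M.trajProb (constPolicy S H a₁)) fun D : Fin N → Trajectory S A H =>
        M.tvLoss D (constPolicy S H a₁)) / 4 ≤
      M.value (constPolicy S H a₁) - M.expectedAILValue (constPolicy S H a₁) N := by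
  have hE := constPolicy_mem_policies (S := S) (H := H) a₁
  have hle := iidExpect_mono (M.trajProb_nonneg hE) fun (D : Fin N → Trajectory S A H) hD =>
    hM.integral_value_tvAILLaw_le ha hr hN fun i =>
      snd_eq_of_trajProb_constPolicy_ne_zero (hD i)
  simp only [iidExpect_sub, iidExpect_const (hM.sum_trajProb hE), div_eq_mul_inv,
    iidExpect_mul_const] at hle
  rw [expectedAILValue_eq_iidExpect, div_eq_mul_inv]
  linarith

end EpisodicMDP

section IsolatedAbsorbing

variable {S A : Type*} [Fintype S] [Fintype A] [DecidableEq S] [DecidableEq A] {H N : ℕ}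

omit [DecidableEq S] in
lemma IsolatedAbsorbing.exists_eq_constPolicy {M : EpisodicMDP S A H} {πE : PolicySpace S A H}
    (hM : IsolatedAbsorbing M πE) (hE : πE ∈ policies S A H) :
    ∃ a₁, πE = constPolicy S H a₁ ∧ ∀ h s a, M.r h s a = if a = a₁ then 1 else 0 := by
  obtain ⟨-, a₁, ha₁⟩ := hM
  refine ⟨a₁, ?_, fun h s a => ?_⟩
  · ext ⟨h, s, a⟩
    rw [constPolicy_apply]
    split_ifs with ha
    · exact ha ▸ (ha₁ h s).1
    · exact policies_apply_eq_zero hE (ha₁ h s).1 ha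
  · split_ifs with ha
    · exact ha ▸ (ha₁ h s).2.1
    · exact (ha₁ h s).2.2 a ha

theorem IsolatedAbsorbing.le_value_sub_expectedAILValue [Nontrivial A] {M : EpisodicMDP S A H}
    {πE : PolicySpace S A H} (hM : IsolatedAbsorbing M πE) (hE : πE ∈ policies S A H)
    (hN : 0 < N) :
    H / 8 * ∑ s, (1 - M.ρ s) * min (M.ρ s) √(M.ρ s / N) ≤
      M.value πE - M.expectedAILValue πE N := by
  obtain ⟨a₁, rfl, hr⟩ := hM.exists_eq_constPolicy hE
  obtain ⟨a₂, ha⟩ := exists_ne a₁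
  have hP : M.IsAbsorbing := hM.1
  have hloss := hP.le_iidExpect_tvLoss hE hN
  have hterm : ∀ h s, ∑ a, (1 - M.occupancy (constPolicy S H a₁) h s a) / 2 *
      min (M.occupancy (constPolicy S H a₁) h s a)
        √(M.occupancy (constPolicy S H a₁) h s a / N) =
      (1 - M.ρ s) * min (M.ρ s) √(M.ρ s / N) / 2 := fun h s => by
    simp only [hP.occupancy_eq hE, constPolicy_apply]
    rw [Finset.sum_eq_single a₁ (by simp +contextual) (by simp)]
    simp only [if_true, mul_one]
    ring
  simp only [hterm, ← Finset.sum_div, Finset.sum_const, Finset.card_univ, Fintype.card_fin,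
    nsmul_eq_mul] at hloss
  linarith [hP.iidExpect_tvLoss_div_four_le ha.symm hr hN]

/-- The MDP in which every action keeps every state in place, the initial distribution is `ρ`, and
the action `a₁` has reward `1`, all other actions having reward `0`. -/
noncomputable def isolatedAbsorbingMDP (H : ℕ) (ρ : stdSimplex ℝ S) (a₁ : A) :
    EpisodicMDP S A H where
  ρ := ρ
  ρ_mem := ρ.2
  P _ s _ := Pi.single s 1
  P_mem _ s _ := single_mem_stdSimplex ℝ s
  r _ _ a := if a = a₁ then 1 else 0
  r_mem _ _ a := by split_ifs <;> simp

omit [Fintype A] in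
lemma isolatedAbsorbing_isolatedAbsorbingMDP (H : ℕ) (ρ : stdSimplex ℝ S) (a₁ : A) :
    IsolatedAbsorbing (isolatedAbsorbingMDP H ρ a₁) (constPolicy S H a₁) :=
  ⟨fun _ _ _ => Pi.single_eq_same _ _, a₁, fun _ _ =>
    ⟨by simp, if_pos rfl, fun _ ha => if_neg ha⟩⟩

end IsolatedAbsorbing

lemma min_one_sqrt_div_le {n N : ℝ} (hn : 2 ≤ n) :
    min 1 √(n / N) / 2 ≤ n * ((1 - n⁻¹) * min n⁻¹ √(n⁻¹ / N)) := by
  have hn₀ : 0 < n := by linarith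
  have hscale : n * min n⁻¹ √(n⁻¹ / N) = min 1 √(n / N) := by
    rw [mul_min_of_nonneg _ _ hn₀.le, mul_inv_cancel₀ hn₀.ne']
    nth_rewrite 1 [← Real.sqrt_sq hn₀.le]
    rw [← Real.sqrt_mul (sq_nonneg n)]
    congr 2
    field_simp
  have hhalf : n⁻¹ ≤ 1 / 2 := by
    rw [inv_eq_one_div]
    exact one_div_le_one_div_of_le two_pos hn
  calc min 1 √(n / N) / 2 = 1 / 2 * min 1 √(n / N) := by ring
    _ ≤ (1 - n⁻¹) * min 1 √(n / N) := by
        gcongr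
        linarith
    _ = n * ((1 - n⁻¹) * min n⁻¹ √(n⁻¹ / N)) := by rw [← hscale]; ring

end ImitationLearning

open ImitationLearning

theorem mainTheorem5 :
    ∃ c : ℝ, 0 < c ∧
      ∀ (S A : Type*) [Fintype S] [Fintype A] [DecidableEq S] [DecidableEq A] (H : ℕ),
        2 ≤ Fintype.card S → 2 ≤ Fintype.card A → 1 ≤ H →
        ∃ (M : ImitationLearning.EpisodicMDP S A H) (πE : ImitationLearning.PolicySpace S A H),
          πE ∈ ImitationLearning.policies S A H ∧
          ImitationLearning.IsolatedAbsorbing M πE ∧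
          ∀ N : ℕ, 1 ≤ N →
            (∀ D : Fin N → ImitationLearning.Trajectory S A H,
              IsProbabilityMeasure (M.tvAILLaw D) ∧
              Integrable (fun π => M.value π) (M.tvAILLaw D)) ∧
            c * min (H : ℝ) (H * Real.sqrt ((Fintype.card S : ℝ) / N)) ≤
              M.value πE - M.expectedAILValue πE N := by
  refine ⟨1 / 16, by norm_num, fun S A _ _ _ _ H hS hA _ => ?_⟩
  have : Nonempty S := Fintype.card_pos_iff.1 (by omega)
  have : Nontrivial A := Fintype.one_lt_card_iff_nontrivial.1 hA
  let a₁ := Classical.arbitrary A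
  let M := isolatedAbsorbingMDP (A := A) H (stdSimplex.barycenter (𝕜 := ℝ) (X := S)) a₁
  have hM : IsolatedAbsorbing M (constPolicy S H a₁) := isolatedAbsorbing_isolatedAbsorbingMDP ..
  have hP : M.IsAbsorbing := hM.1
  have hE : constPolicy S H a₁ ∈ policies S A H := constPolicy_mem_policies a₁
  refine ⟨M, constPolicy S H a₁, hE, hM, fun N hN => ⟨fun D =>
    ⟨hP.isProbabilityMeasure_tvAILLaw D, hP.integrable_tvAILLaw D M.continuous_value⟩, ?_⟩⟩
  refine le_trans ?_ (hM.le_value_sub_expectedAILValue hE hN)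
  have hρ : ∀ s, M.ρ s = (Fintype.card S : ℝ)⁻¹ := stdSimplex.barycenter_apply
  simp only [hρ, Finset.sum_const, Finset.card_univ, nsmul_eq_mul]
  calc 1 / 16 * min (H : ℝ) (H * √(Fintype.card S / N))
      = H / 8 * (min 1 √(Fintype.card S / N) / 2) := by
        rw [← mul_one (H : ℝ), mul_assoc, one_mul, ← mul_min_of_nonneg _ _ H.cast_nonneg]
        ring
    _ ≤ _ := by
        gcongr
        exact min_one_sqrt_div_le (by exact_mod_cast hS)
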